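/- Let $M_1,\dots,M_m$ be smooth manifolds (without boundary, Hausdorff, second countable) of common dimension $n$, let $c: M_1\times\cdots\times M_m\to\mathbb{R}$ be continuous, let $x=(x_1,\dots,x_m)$ be a point of the product, and suppose that $c$ is $C^2$ near $x$. For $i\neq j$ let $D^2_{x_ix_j}c$ be the $n\times n$ matrix of mixed second partial derivatives $\partial^2c/\partial x_i^{\alpha}\partial x_j^{\beta}$ at $x$ in local coordinates. For each partition $p=\{p_+,p_-\}$ of $\{1,\dots,m\}$ into two disjoint nonempty subsets let $g_p$ be the symmetric $mn\times mn$ matrix whose $(i,j)$ block is $0$ if $i,j$ both lie in $p_+$ or both lie in $p_-$, and is $D^2_{x_ix_j}c$ otherwise, and let $G$ be the convex hull of all the $g_p$. Assume that $c$ satisfies (MMA2) at $x$: some $g\in G$ has signature $((m-1)n,\,n,\,0)$, i.e. $(m-1)n$ positive, $n$ negative and no zero eigenvalues, counted with multiplicity. Then there is a neighbourhood $N$ of $x$ such that, for all compactly supported Borel probability measures $\mu_1,\dots,\mu_m$ on $M_1,\dots,M_m$ and every measure $\gamma$ that minimizes $\int c\,d\gamma$ among the positive measures on $M_1\times\cdots\times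 M_m$ with marginals $\mu_1,\dots,\mu_m$, the set $N\cap\operatorname{spt}(\gamma)$ is contained in an $n$-dimensional Lipschitz submanifold of $M_1\times\cdots\times M_m$, that is, in a set which near each of its points coincides, in some chart of the product, with the graph of a Lipschitz function from an $n$-dimensional linear subspace to a complementary subspace. -/

import Mathlib

open MeasureTheory Topology
open scoped Manifold ContDiff NNReal

noncomputable section

namespace MultiMarginal

/-- The model with corners of a product of `m` boundaryless manifolds of dimension `n`; the model
vector space is `Fin m → EuclideanSpace ℝ (Fin n)`. -/
abbrev prodModel (m n : ℕ) :=
  ModelWithCorners.pi (fun _ : Fin m => 𝓡 n)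

section Cost

variable {m n : ℕ} {M : Fin m → Type*} [∀ i, TopologicalSpace (M i)]
  [∀ i, ChartedSpace (EuclideanSpace ℝ (Fin n)) (M i)]

/-- Local coordinates of the point `x` of the product, in the preferred charts at the `x i`. -/
def localPoint (x : ∀ i, M i) : Fin m → EuclideanSpace ℝ (Fin n) :=
  fun i => chartAt (EuclideanSpace ℝ (Fin n)) (x i) (x i)

/-- The cost `c` read in the product of the preferred charts at the `x i`. -/
def localCost (c : (∀ i, M i) → ℝ) (x : ∀ i, M i) (u : Fin m → EuclideanSpace ℝ (Fin n)) : ℝ :=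
  c fun i => (chartAt (EuclideanSpace ℝ (Fin n)) (x i)).symm (u i)

/-- The `α`-th coordinate direction in the `i`-th factor. -/
def coordDir (a : Fin m × Fin n) : Fin m → EuclideanSpace ℝ (Fin n) :=
  Pi.single a.1 (EuclideanSpace.single a.2 (1 : ℝ))

/-- The second partial derivative `∂²c / ∂x_i^α ∂x_j^β` at `x` in local coordinates, for
`a = (i, α)` and `b = (j, β)`. For `i ≠ j` these are the entries of the matrix `D²_{x_i x_j} c`. -/
def secondPartial (c : (∀ i, M i) → ℝ) (x : ∀ i, M i) (a b : Fin m × Fin n) : ℝ :=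
  fderiv ℝ (fun u => fderiv ℝ (localCost (n := n) c x) u (coordDir b))
    (localPoint (n := n) x) (coordDir a)

/-- The symmetric form `g_p = ∑_{i ∈ p₊, j ∈ p₋} (D²_{x_i x_j} c + D²_{x_j x_i} c)` of the partition
`{p, pᶜ}`, as an `mn × mn` matrix: the `i, j` block is zero if `i` and `j` lie in the same part and
is `D²_{x_i x_j} c` otherwise. -/
def partitionForm (c : (∀ i, M i) → ℝ) (x : ∀ i, M i) (p : Finset (Fin m)) :
    Matrix (Fin m × Fin n) (Fin m × Fin n) ℝ :=
  Matrix.of fun a b => if (a.1 ∈ p ↔ b.1 ∈ p) then 0 else secondPartial c x a b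

/-- The convex hull `G` of the forms `g_p`, over all partitions of the index set into two nonempty
parts. -/
def partitionHull (n : ℕ) {m : ℕ} {M : Fin m → Type*} [∀ i, TopologicalSpace (M i)]
    [∀ i, ChartedSpace (EuclideanSpace ℝ (Fin n)) (M i)]
    (c : (∀ i, M i) → ℝ) (x : ∀ i, M i) : Set (Matrix (Fin m × Fin n) (Fin m × Fin n) ℝ) :=
  convexHull ℝ (partitionForm c x '' {p | p.Nonempty ∧ pᶜ.Nonempty})

end Cost

/-- The symmetric matrix `A` has `p` positive, `q` negative and `r` zero eigenvalues, counted with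
multiplicity. -/
def HasSignature {ι : Type*} [Fintype ι] [DecidableEq ι] (A : Matrix ι ι ℝ) (p q r : ℕ) : Prop :=
  A.charpoly.roots.countP (fun t => 0 < t) = p ∧
  A.charpoly.roots.countP (fun t => t < 0) = q ∧
  A.charpoly.roots.countP (fun t => t = 0) = r

/-- Multi-marginal non-degeneracy of the cost `c` at `x`: some form in the convex hull `G` has
signature `((m - 1) n, n, 0)`. -/
def MMA2 (n : ℕ) {m : ℕ} {M : Fin m → Type*} [∀ i, TopologicalSpace (M i)]
    [∀ i, ChartedSpace (EuclideanSpace ℝ (Fin n)) (M i)]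
    (c : (∀ i, M i) → ℝ) (x : ∀ i, M i) : Prop :=
  ∃ g ∈ partitionHull n c x, HasSignature g ((m - 1) * n) n 0

/-- The joint measures on the product whose marginals are the `μ i`. -/
def couplings {m : ℕ} {M : Fin m → Type*} [∀ i, MeasurableSpace (M i)]
    (μ : ∀ i, Measure (M i)) : Set (Measure (∀ i, M i)) :=
  {γ | ∀ i, γ.map (fun y => y i) = μ i}

/-- `γ` minimizes the total cost among all joint measures with marginals `μ i`. -/
def IsOptimal {m : ℕ} {M : Fin m → Type*} [∀ i, MeasurableSpace (M i)]
    (c : (∀ i, M i) → ℝ) (μ : ∀ i, Measure (M i)) (γ : Measure (∀ i, M i)) : Prop :=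
  γ ∈ couplings μ ∧ ∀ γ' ∈ couplings μ, ∫ y, c y ∂γ ≤ ∫ y, c y ∂γ'

/-- `S` is a `d`-dimensional Lipschitz submanifold of the (boundaryless) manifold `X`: near each of
its points, in some chart of `X`, it coincides with the graph of a Lipschitz function from a
`d`-dimensional linear subspace `V` to a complementary subspace `W` of the model vector space. -/
def IsLipschitzSubmanifold {E H X : Type*} [NormedAddCommGroup E] [NormedSpace ℝ E]
    [TopologicalSpace H] (I : ModelWithCorners ℝ E H) [TopologicalSpace X]
    [ChartedSpace H X] (d : ℕ) (S : Set X) : Prop :=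
  ∀ y ∈ S, ∃ φ ∈ atlas H X, ∃ U : Set X, IsOpen U ∧ y ∈ U ∧ U ⊆ φ.source ∧
    ∃ V W : Submodule ℝ E, IsCompl V W ∧ FiniteDimensional ℝ V ∧ Module.finrank ℝ V = d ∧
      ∃ (f : V → W) (K : ℝ≥0), LipschitzWith K f ∧
        ∀ z ∈ U, (z ∈ S ↔ ∃ v : V, φ.extend I z = (v : E) + (f v : E))

end MultiMarginal

end

namespace MultiMarginal

/-! ### Spectral cone of a nondegenerate symmetric matrix -/

section LinearAlgebra

variable {ι : Type*} [Fintype ι] [DecidableEq ι] {A : Matrix ι ι ℝ}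

/-! If exchanging the coordinates in `p` of two support points `y`, `z` lowered the total cost,
moving a little mass along the exchange would beat `γ`; hence the support is `c`-monotone
(`add_le_of_mem_support`). In a chart the change of cost under the exchange is a second difference
of `c`, equal up to a small multiple of `‖y - z‖ ^ 2` to half the form `g_p` at `y - z`. So near `x`
every `g_p`, and by linearity in the matrix every `g ∈ G`, is almost nonpositive on `y - z`
(`exists_form_le_of_monotone`).

For the `g` of (MMA2) this confines `y - z` to a cone around the `n`-dimensional negative eigenspace
(`exists_isCompl_cone`), so the support near `x` lies in a Lipschitz graph over that space
(`exists_lipschitz_graph`). The radius depends only on `c` and `x`, so one neighbourhood serves all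
measures. -/

theorem dotProduct_mulVec_eq_sum_eigenvalues (hA : A.IsHermitian) (x : EuclideanSpace ℝ ι) :
    x.ofLp ⬝ᵥ A.mulVec x.ofLp =
      ∑ i, hA.eigenvalues i * inner ℝ (hA.eigenvectorBasis i) x ^ 2 := by
  have hAt : A.transpose = A := by simpa [Matrix.IsHermitian] using hA
  have key : ∀ i, inner ℝ (hA.eigenvectorBasis i) (WithLp.toLp 2 (A.mulVec x.ofLp)) =
      hA.eigenvalues i * inner ℝ (hA.eigenvectorBasis i) x := by
    intro i
    simp only [EuclideanSpace.inner_eq_star_dotProduct, star_trivial]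
    rw [dotProduct_comm, Matrix.dotProduct_mulVec, ← Matrix.mulVec_transpose, hAt,
      hA.mulVec_eigenvectorBasis, smul_dotProduct, smul_eq_mul, dotProduct_comm]
  have h := (hA.eigenvectorBasis).sum_inner_mul_inner x (WithLp.toLp 2 (A.mulVec x.ofLp))
  have h2 : inner ℝ x (WithLp.toLp 2 (A.mulVec x.ofLp)) = x.ofLp ⬝ᵥ A.mulVec x.ofLp := by
    simp only [EuclideanSpace.inner_eq_star_dotProduct, star_trivial]
    rw [dotProduct_comm]
  rw [← h2, ← h]
  refine Finset.sum_congr rfl fun i _ => ?_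
  rw [key, real_inner_comm x]
  ring

theorem countP_roots_charpoly (hA : A.IsHermitian) (P : ℝ → Prop) [DecidablePred P] :
    A.charpoly.roots.countP P = (Finset.univ.filter fun i => P (hA.eigenvalues i)).card := by
  rw [hA.roots_charpoly_eq_eigenvalues, Multiset.countP_map]
  rfl

/-- If a symmetric matrix without zero eigenvalue has `q` negative eigenvalues, then the vectors
on which its quadratic form is almost nonpositive lie in a cone around a `q`-dimensional subspace. -/
theorem exists_isCompl_cone (hA : A.IsHermitian) {p q : ℕ} (hs : HasSignature A p q 0) :
    ∃ V W : Submodule ℝ (EuclideanSpace ℝ ι), IsCompl V W ∧ Module.finrank ℝ V = q ∧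
      ∃ ε > 0, ∃ K : ℝ, 0 ≤ K ∧ ∀ v ∈ V, ∀ w ∈ W,
        (v + w).ofLp ⬝ᵥ A.mulVec (v + w).ofLp ≤ ε * ‖v + w‖ ^ 2 → ‖w‖ ≤ K * ‖v‖ := by
  obtain ⟨-, hneg, hzero⟩ := hs
  rw [countP_roots_charpoly hA] at hneg hzero
  have hne : ∀ i, hA.eigenvalues i ≠ 0 := by
    intro i hi
    rw [Finset.card_eq_zero] at hzero
    have : i ∈ Finset.univ.filter fun i => hA.eigenvalues i = 0 := by simp [hi]
    rw [hzero] at this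
    simp at this
  set b := hA.eigenvectorBasis with hb
  set l := hA.eigenvalues with hl
  let Q : Set ι := {i | l i < 0}
  obtain ⟨lam, hlam, hlam0⟩ : ∃ lam : ℝ, (∀ i, lam ≤ |l i|) ∧ 0 < lam := by
    have h1 : ∀ᶠ t in 𝓝[>] (0 : ℝ), ∀ i, t ≤ |l i| := by
      refine Filter.eventually_all.2 fun i => ?_
      exact nhdsWithin_le_nhds (eventually_le_nhds (abs_pos.2 (hne i)))
    exact (h1.and self_mem_nhdsWithin).exists
  obtain ⟨Lam, hLam, hLam0⟩ : ∃ Lam : ℝ, (∀ i, |l i| ≤ Lam) ∧ 0 < Lam := by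
    have h1 : ∀ᶠ t in Filter.atTop, ∀ i, |l i| ≤ t :=
      Filter.eventually_all.2 fun i => Filter.eventually_ge_atTop _
    exact (h1.and (Filter.eventually_gt_atTop 0)).exists
  have hli : LinearIndependent ℝ b := b.orthonormal.linearIndependent
  have horth : ∀ s : Set ι, ∀ v ∈ Submodule.span ℝ (b '' s), ∀ i ∉ s, inner ℝ (b i) v = 0 := by
    intro s v hv i hi
    induction hv using Submodule.span_induction with
    | mem x hx =>
      obtain ⟨j, hj, rfl⟩ := hx
      exact b.orthonormal.2 (fun h => hi (h ▸ hj))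
    | zero => simp
    | add x y _ _ hx hy => rw [inner_add_right, hx, hy, add_zero]
    | smul a x _ hx => rw [inner_smul_right, hx, mul_zero]
  refine ⟨Submodule.span ℝ (b '' Q), Submodule.span ℝ (b '' Qᶜ), ⟨?_, ?_⟩, ?_, lam / 2,
    half_pos hlam0, √((2 * Lam + lam) / lam), Real.sqrt_nonneg _, ?_⟩
  · exact hli.disjoint_span_image disjoint_compl_right
  · rw [codisjoint_iff, ← Submodule.span_union, ← Set.image_union, Set.union_compl_self,
      Set.image_univ, ← b.coe_toBasis, b.toBasis.span_eq]
  · have h1 : LinearIndependent ℝ (fun i : Q => b i) := hli.comp _ Subtype.val_injective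
    have h2 : b '' Q = Set.range (fun i : Q => b i) := by rw [Set.image_eq_range]
    classical
    rw [h2, finrank_span_eq_card h1, ← hneg, Fintype.card_subtype]
    rfl
  · intro v hv w hw hq
    rw [dotProduct_mulVec_eq_sum_eigenvalues hA, ← b.sum_sq_norm_inner_right (v + w),
      Finset.mul_sum] at hq
    have hsum : lam * ‖w‖ ^ 2 ≤ (2 * Lam + lam) * ‖v‖ ^ 2 := by
      -- In each eigendirection only one of `v`, `w` has a component: `v` where `l i ≤ -lam`, `w`
      -- where `l i ≥ lam`. Subtracting `lam / 2` keeps a gap of `lam / 2` for `w` and costs at most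
      -- `Lam + lam / 2` for `v`.
      have hterm : ∀ i, lam * ‖inner ℝ (b i) w‖ ^ 2 - (2 * Lam + lam) * ‖inner ℝ (b i) v‖ ^ 2 ≤
          2 * (l i * inner ℝ (b i) (v + w) ^ 2 - lam / 2 * ‖inner ℝ (b i) (v + w)‖ ^ 2) := by
        intro i
        rw [inner_add_right]
        by_cases hi : l i < 0
        · rw [horth _ w hw i (by simpa [Q] using hi)]
          have := hLam i
          rw [abs_of_neg hi] at this
          simp only [Real.norm_eq_abs, sq_abs, add_zero]
          nlinarith [sq_nonneg (inner ℝ (b i) v)]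
        · rw [horth _ v hv i (by simpa [Q] using hi)]
          have := hlam i
          rw [abs_of_nonneg (not_lt.1 hi)] at this
          simp only [Real.norm_eq_abs, sq_abs, zero_add]
          nlinarith [sq_nonneg (inner ℝ (b i) w)]
      have h3 := Finset.sum_le_sum fun i (_ : i ∈ Finset.univ) => hterm i
      rw [Finset.sum_sub_distrib, ← Finset.mul_sum, ← Finset.mul_sum, ← Finset.mul_sum,
        Finset.sum_sub_distrib, b.sum_sq_norm_inner_right, b.sum_sq_norm_inner_right] at h3
      linarith
    refine le_of_sq_le_sq ?_ (by positivity)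
    rw [mul_pow, Real.sq_sqrt (by positivity), div_mul_eq_mul_div, le_div_iff₀ hlam0]
    linarith

end LinearAlgebra

/-! ### Lipschitz graphs and second differences -/

/-- A set whose differences lie in a cone around `V` is contained in a Lipschitz graph over `V`. -/
theorem exists_lipschitz_graph {E : Type*} [NormedAddCommGroup E] [NormedSpace ℝ E]
    [FiniteDimensional ℝ E] {V W : Submodule ℝ E} (hVW : IsCompl V W) {s : Set E} {K : ℝ≥0}
    (hs : ∀ y ∈ s, ∀ z ∈ s, ∀ v ∈ V, ∀ w ∈ W, y - z = v + w → ‖w‖ ≤ K * ‖v‖) :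
    ∃ (f : V → W) (K' : ℝ≥0), LipschitzWith K' f ∧ ∀ y ∈ s, ∃ v : V, y = (v : E) + (f v : E) := by
  let P := V.projectionOnto W hVW
  let R := W.projectionOnto V hVW.symm
  have hdec : ∀ y : E, y = (P y : E) + (R y : E) := fun y =>
    (Submodule.projection_add_projection_eq_self hVW y).symm
  have hest : ∀ y ∈ s, ∀ z ∈ s, ‖R y - R z‖ ≤ K * ‖P y - P z‖ := by
    intro y hy z hz
    refine hs y hy z hz _ (P y - P z).2 _ (R y - R z).2 ?_
    rw [← map_sub, ← map_sub]
    exact hdec _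
  have hinj : Set.InjOn P s := by
    intro y hy z hz h
    have h1 := hest y hy z hz
    rw [h, sub_self, norm_zero, mul_zero, norm_le_zero_iff, sub_eq_zero] at h1
    rw [hdec y, hdec z, h, h1]
  -- The values off `P '' s` are arbitrary; only the restriction is Lipschitz, and it is extended to
  -- `V` below with a possibly larger constant.
  let f₀ : V → W := fun v => R (Function.invFunOn P s v)
  have hf₀ : ∀ y ∈ s, f₀ (P y) = R y := by
    intro y hy
    simp only [f₀]
    rw [hinj.leftInvOn_invFunOn hy]
  have hL : LipschitzOnWith K f₀ (P '' s) := by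
    refine LipschitzOnWith.of_dist_le_mul ?_
    rintro _ ⟨y, hy, rfl⟩ _ ⟨z, hz, rfl⟩
    rw [hf₀ y hy, hf₀ z hz, dist_eq_norm, dist_eq_norm]
    exact hest y hy z hz
  obtain ⟨f, hf, hff⟩ := hL.extend_finite_dimension
  refine ⟨f, _, hf, fun y hy => ⟨P y, ?_⟩⟩
  rw [← hff (Set.mem_image_of_mem P hy), hf₀ y hy]
  exact hdec y

/-- Second-order Taylor estimate for the second difference of `f` at a point where `f` is `C²`. -/
theorem eventually_second_difference_le {E : Type*} [NormedAddCommGroup E] [NormedSpace ℝ E]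
    {f : E → ℝ} {u₀ : E} (hf : ContDiffAt ℝ 2 f u₀) {ε : ℝ} (hε : 0 < ε) :
    ∃ r > 0, ∀ z s t : E, z ∈ Metric.ball u₀ r → z + s ∈ Metric.ball u₀ r →
      z + t ∈ Metric.ball u₀ r → z + s + t ∈ Metric.ball u₀ r →
      |f (z + s + t) - f (z + s) - (f (z + t) - f z) - fderiv ℝ (fderiv ℝ f) u₀ t s| ≤
        ε * ‖t‖ * ‖s‖ := by
  have h1 : HasStrictFDerivAt (fderiv ℝ f) (fderiv ℝ (fderiv ℝ f) u₀) u₀ :=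
    (hf.fderiv_right (m := 1) (by norm_num)).hasStrictFDerivAt (by norm_num)
  have h2 := h1.isLittleO.def hε
  have h3 : ∀ᶠ y in 𝓝 u₀, DifferentiableAt ℝ f y :=
    (hf.eventually (by simp)).mono fun y hy => hy.differentiableAt (by norm_num)
  rw [nhds_prod_eq] at h2
  obtain ⟨S, hS, h2⟩ := Filter.mem_prod_self_iff.1 h2
  obtain ⟨r, hr, hball⟩ := Metric.mem_nhds_iff.1 (Filter.inter_mem hS h3)
  refine ⟨r, hr, fun z s t hz hzs hzt hzst => ?_⟩
  have hconv : Convex ℝ (Metric.ball u₀ r) := convex_ball _ _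
  have hsub : ∀ v ∈ segment ℝ z (z + s), v ∈ Metric.ball u₀ r ∧ v + t ∈ Metric.ball u₀ r := by
    intro v hv
    refine ⟨hconv.segment_subset hz hzs hv, ?_⟩
    refine hconv.segment_subset hzt hzst ?_
    rwa [add_comm v t, add_comm z t, add_comm (z + s) t, mem_segment_translate]
  -- Mean value inequality for `v ↦ f (v + t) - f v`: strict differentiability of `fderiv ℝ f` puts
  -- its derivative within `ε * ‖t‖` of the second derivative at `u₀` applied to `t`.
  have h4 := Convex.norm_image_sub_le_of_norm_hasFDerivWithin_le' (𝕜 := ℝ)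
    (f := fun v => f (v + t) - f v) (f' := fun v => fderiv ℝ f (v + t) - fderiv ℝ f v)
    (φ := fderiv ℝ (fderiv ℝ f) u₀ t) (C := ε * ‖t‖) (s := segment ℝ z (z + s))
    (x := z) (y := z + s) ?_ ?_ (convex_segment _ _) (left_mem_segment _ _ _)
    (right_mem_segment _ _ _)
  · simp only [add_sub_cancel_left] at h4
    rw [← Real.norm_eq_abs]
    convert h4 using 2
  · intro v hv
    have hv' := hsub v hv
    have ha : HasFDerivAt (fun v => f (v + t)) (fderiv ℝ f (v + t)) v := by
      rw [hasFDerivAt_comp_add_right]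
      exact (hball hv'.2).2.hasFDerivAt
    exact (ha.sub (hball hv'.1).2.hasFDerivAt).hasFDerivWithinAt
  · intro v hv
    have hv' := hsub v hv
    have := h2 (Set.mk_mem_prod (hball hv'.2).1 (hball hv'.1).1)
    simpa using this

theorem contDiffAt_localCost {m n : ℕ} {M : Fin m → Type*} [∀ i, TopologicalSpace (M i)]
    [∀ i, ChartedSpace (EuclideanSpace ℝ (Fin n)) (M i)] {c : (∀ i, M i) → ℝ} {x : ∀ i, M i}
    (hc : ContMDiffAt (prodModel m n) 𝓘(ℝ, ℝ) 2 c x) :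
    ContDiffAt ℝ 2 (localCost (n := n) c x) (localPoint x) := by
  have h := (contMDiffAt_iff.1 hc).2
  have hr : Set.range (prodModel m n) = Set.univ := by
    rw [Set.range_eq_univ]
    intro u
    exact ⟨u, rfl⟩
  rw [hr, contDiffWithinAt_univ] at h
  exact h

/-! ### Partition forms as second derivatives -/

section Form

variable {m n : ℕ} {M : Fin m → Type*} [∀ i, TopologicalSpace (M i)]
    [∀ i, ChartedSpace (EuclideanSpace ℝ (Fin n)) (M i)] {c : (∀ i, M i) → ℝ} {x : ∀ i, M i}

theorem secondPartial_eq (hc : ContDiffAt ℝ 2 (localCost (n := n) c x) (localPoint x))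
    (a b : Fin m × Fin n) :
    secondPartial c x a b = fderiv ℝ (fderiv ℝ (localCost (n := n) c x)) (localPoint x)
      (coordDir a) (coordDir b) := by
  have hd : DifferentiableAt ℝ (fderiv ℝ (localCost (n := n) c x)) (localPoint x) :=
    (hc.fderiv_right (m := 1) (by norm_num)).differentiableAt (by norm_num)
  unfold secondPartial
  rw [fderiv_clm_apply hd (differentiableAt_const _)]
  simp

theorem secondPartial_symm (hc : ContDiffAt ℝ 2 (localCost (n := n) c x) (localPoint x))
    (a b : Fin m × Fin n) : secondPartial c x a b = secondPartial c x b a := by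
  rw [secondPartial_eq hc, secondPartial_eq hc]
  exact hc.isSymmSndFDerivAt (by simp) _ _

theorem isHermitian_of_mem_partitionHull
    (hc : ContDiffAt ℝ 2 (localCost (n := n) c x) (localPoint x))
    {g : Matrix (Fin m × Fin n) (Fin m × Fin n) ℝ} (hg : g ∈ partitionHull n c x) :
    g.IsHermitian := by
  have hconv : Convex ℝ {A : Matrix (Fin m × Fin n) (Fin m × Fin n) ℝ | A.IsHermitian} := by
    intro A hA B hB s t _ _ _
    simp only [Set.mem_ofPred_eq, Matrix.IsHermitian, Matrix.conjTranspose_add,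
      Matrix.conjTranspose_smul, star_trivial] at *
    rw [hA, hB]
  refine convexHull_min ?_ hconv hg
  rintro _ ⟨p, -, rfl⟩
  refine Matrix.IsHermitian.ext fun a b => ?_
  simp only [partitionForm, Matrix.of_apply, star_trivial]
  rw [secondPartial_symm hc b a]
  congr 1
  exact propext iff_comm

theorem sum_coordDir (u : Fin m → EuclideanSpace ℝ (Fin n)) :
    u = ∑ a : Fin m × Fin n, u a.1 a.2 • coordDir a := by
  ext i α
  simp [Fintype.sum_prod_type, coordDir, Finset.sum_apply, Pi.single_apply, apply_ite,
    Finset.sum_ite_eq]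

/-- Only the two blocks linking `p` to its complement survive, and they contribute equally because
the second derivative is symmetric; hence the factor 2. -/
theorem dotProduct_partitionForm
    (hc : ContDiffAt ℝ 2 (localCost (n := n) c x) (localPoint x)) (p : Finset (Fin m))
    (u : Fin m → EuclideanSpace ℝ (Fin n)) :
    (fun a : Fin m × Fin n => u a.1 a.2) ⬝ᵥ
        (partitionForm c x p).mulVec (fun a : Fin m × Fin n => u a.1 a.2) =
      2 * fderiv ℝ (fderiv ℝ (localCost (n := n) c x)) (localPoint x)
        (p.piecewise 0 u) (p.piecewise u 0) := by
  set B := fderiv ℝ (fderiv ℝ (localCost (n := n) c x)) (localPoint x) with hB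
  have hsymm : ∀ v w, B v w = B w v := fun v w => hc.isSymmSndFDerivAt (by simp) _ _
  have hexp : ∀ v w : Fin m → EuclideanSpace ℝ (Fin n),
      B v w = ∑ a : Fin m × Fin n, ∑ b : Fin m × Fin n,
        v a.1 a.2 * w b.1 b.2 * secondPartial c x a b := by
    intro v w
    conv_lhs => rw [sum_coordDir v, sum_coordDir w]
    simp only [map_sum, map_smul, sum_apply, smul_apply,
      smul_eq_mul, Finset.mul_sum]
    rw [Finset.sum_comm]
    refine Finset.sum_congr rfl fun a _ => ?_
    refine Finset.sum_congr rfl fun b _ => ?_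
    rw [secondPartial_eq hc]
    ring
  rw [two_mul]
  nth_rewrite 2 [hsymm]
  rw [hexp, hexp, ← Finset.sum_add_distrib]
  simp only [dotProduct, Matrix.mulVec, Finset.mul_sum, ← Finset.sum_add_distrib, partitionForm,
    Matrix.of_apply, Finset.piecewise]
  refine Finset.sum_congr rfl fun a _ => Finset.sum_congr rfl fun b _ => ?_
  by_cases ha : a.1 ∈ p <;> by_cases hb : b.1 ∈ p <;> simp [ha, hb] <;> ring

end Form

/-! ### Optimal couplings and `c`-monotonicity -/

theorem isProbabilityMeasure_of_mem_couplings {m : ℕ} {M : Fin m → Type*}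
    [∀ i, MeasurableSpace (M i)] {μ : ∀ i, Measure (M i)} {γ : Measure (∀ i, M i)}
    [∀ i, IsProbabilityMeasure (μ i)] (i₀ : Fin m) (hγ : γ ∈ couplings μ) : IsProbabilityMeasure γ := by
  constructor
  have h : γ.map (fun y => y i₀) Set.univ = 1 := by rw [hγ i₀, measure_univ]
  rwa [Measure.map_apply (measurable_pi_apply i₀) MeasurableSet.univ, Set.preimage_univ] at h

section Couplings

variable {m : ℕ} {M : Fin m → Type*} [∀ i, TopologicalSpace (M i)] [∀ i, T2Space (M i)]
  [∀ i, SecondCountableTopology (M i)] [∀ i, MeasurableSpace (M i)] [∀ i, BorelSpace (M i)]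
  {c : (∀ i, M i) → ℝ} {μ : ∀ i, Measure (M i)} {γ : Measure (∀ i, M i)}

/-- A coupling is concentrated on the product of the compact supports of its marginals, where `c` is
bounded. This keeps the Bochner integrals in `IsOptimal` from taking the default value 0. -/
theorem integrable_of_mem_couplings [IsFiniteMeasure γ] (hc : Continuous c)
    (hμ : ∀ i, IsCompact (μ i).support) (hγ : γ ∈ couplings μ) : Integrable c γ := by
  have hK : IsCompact (Set.univ.pi fun i => (μ i).support) := isCompact_univ_pi hμ
  have hae : ∀ᵐ y ∂γ, y ∈ Set.univ.pi fun i => (μ i).support := by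
    have : ∀ i, ∀ᵐ y ∂γ, y i ∈ (μ i).support := by
      intro i
      have h : ∀ᵐ z ∂(γ.map fun y => y i), z ∈ (μ i).support := by
        rw [hγ i]
        exact Measure.support_mem_ae
      exact ae_of_ae_map (measurable_pi_apply i).aemeasurable h
    filter_upwards [ae_all_iff.2 this] with y hy i _ using hy i
  have := hc.continuousOn.integrableOn_compact (μ := γ) hK
  rwa [IntegrableOn, Measure.restrict_eq_self_of_ae_mem hae] at this

/-- The support of an optimal measure is `c`-monotone: exchanging the coordinates in `p` of two of
its points does not decrease the total cost. -/
theorem add_le_of_mem_support [∀ i, IsProbabilityMeasure (μ i)] (hc : Continuous c)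
    (hμ : ∀ i, IsCompact (μ i).support) (hγ : IsOptimal c μ γ) {y z : ∀ i, M i}
    (hy : y ∈ γ.support) (hz : z ∈ γ.support) (p : Finset (Fin m)) :
    c y + c z ≤ c (p.piecewise y z) + c (p.piecewise z y) := by
  rcases isEmpty_or_nonempty (Fin m) with hm | ⟨⟨i₀⟩⟩
  · rw [Subsingleton.elim (p.piecewise y z) y, Subsingleton.elim (p.piecewise z y) z]
  have hγp := isProbabilityMeasure_of_mem_couplings i₀ hγ.1
  by_contra! hlt
  let T : (∀ i, M i) × (∀ i, M i) → ∀ i, M i := fun w => p.piecewise w.1 w.2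
  let T' : (∀ i, M i) × (∀ i, M i) → ∀ i, M i := fun w => p.piecewise w.2 w.1
  have hTc : Continuous T := by
    refine continuous_pi fun i => ?_
    by_cases hi : i ∈ p
    · simpa [T, hi] using (continuous_apply i).comp' continuous_fst
    · simpa [T, hi] using (continuous_apply i).comp' continuous_snd
  have hT'c : Continuous T' := hTc.comp continuous_swap
  let h : (∀ i, M i) × (∀ i, M i) → ℝ := fun w => c w.1 + c w.2 - (c (T w) + c (T' w))
  have hh : Continuous h := by fun_prop
  have hpos : ∀ᶠ w in 𝓝 (y, z), 0 < h w := by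
    refine hh.continuousAt.eventually (lt_mem_nhds ?_)
    simpa [h, T, T'] using hlt
  rw [nhds_prod_eq] at hpos
  obtain ⟨U₀, hU₀, V₀, hV₀, hUV⟩ := Filter.mem_prod_iff.1 hpos
  obtain ⟨U, hUU, hU, hyU⟩ := mem_nhds_iff.1 hU₀
  obtain ⟨V, hVV, hV, hzV⟩ := mem_nhds_iff.1 hV₀
  have hγU : γ U ≠ 0 := ((Measure.mem_support_iff_forall y).1 hy U (hU.mem_nhds hyU)).ne'
  have hγV : γ V ≠ 0 := ((Measure.mem_support_iff_forall z).1 hz V (hV.mem_nhds hzV)).ne'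
  let a := ProbabilityTheory.cond γ U
  let b := ProbabilityTheory.cond γ V
  have ha : IsProbabilityMeasure a := ProbabilityTheory.cond_isProbabilityMeasure hγU
  have hb : IsProbabilityMeasure b := ProbabilityTheory.cond_isProbabilityMeasure hγV
  have haU : ∀ᵐ u ∂a, u ∈ U := ProbabilityTheory.ae_cond_mem hU.measurableSet
  have hbV : ∀ᵐ u ∂b, u ∈ V := ProbabilityTheory.ae_cond_mem hV.measurableSet
  -- The half bounds each of `t • a`, `t • b` by half of `γ`, so their sum can be removed from `γ`
  -- even if `U` and `V` overlap.
  let t : ℝ≥0 := min (γ U).toNNReal (γ V).toNNReal / 2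
  have ht : 0 < t := by
    have h1 := ENNReal.toNNReal_pos hγU (measure_ne_top _ _)
    have h2 := ENNReal.toNNReal_pos hγV (measure_ne_top _ _)
    exact half_pos (lt_min h1 h2)
  have hcond : ∀ s : Set (∀ i, M i), γ s ≠ 0 → t ≤ (γ s).toNNReal / 2 →
      t • ProbabilityTheory.cond γ s ≤ (2⁻¹ : ℝ≥0) • γ := by
    intro s hs hts
    have h1 : t • ProbabilityTheory.cond γ s ≤
        ((γ s).toNNReal / 2) • ProbabilityTheory.cond γ s := by
      gcongr
    refine h1.trans ?_
    rw [ProbabilityTheory.cond, div_eq_inv_mul, mul_smul]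
    gcongr
    rw [ENNReal.smul_def, ENNReal.coe_toNNReal (measure_ne_top _ _), smul_smul,
      ENNReal.mul_inv_cancel hs (measure_ne_top _ _), one_smul]
    exact Measure.restrict_le_self
  have hle : t • (a + b) ≤ γ := by
    have h1 := hcond U hγU (by simp only [t]; gcongr; exact min_le_left _ _)
    have h2 := hcond V hγV (by simp only [t]; gcongr; exact min_le_right _ _)
    calc t • (a + b) = t • a + t • b := smul_add _ _ _
      _ ≤ (2⁻¹ : ℝ≥0) • γ + (2⁻¹ : ℝ≥0) • γ := add_le_add h1 h2
      _ = γ := by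
        rw [← add_smul]
        norm_num
  let ρ := γ - t • (a + b)
  have hρ : ρ + t • (a + b) = γ := Measure.sub_add_cancel_of_le hle
  let π := a.prod b
  -- The competitor replaces `t • (a + b)` by the two exchanges of independent samples from `a` and
  -- `b`. For each `i`, one of `T`, `T'` takes its coordinate from `a` and the other from `b`, so
  -- the marginals are unchanged.
  let γ' := ρ + t • (π.map T + π.map T')
  have hπ1 : π.map Prod.fst = a := by simp [π]
  have hπ2 : π.map Prod.snd = b := by simp [π]
  have hγ' : γ' ∈ couplings μ := by
    intro i
    have hi : Measurable fun y : ∀ i, M i => y i := measurable_pi_apply i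
    have hsum : (π.map T + π.map T').map (fun y => y i) = (a + b).map fun y => y i := by
      rw [Measure.map_add _ _ hi, Measure.map_add _ _ hi, Measure.map_map hi hTc.measurable,
        Measure.map_map hi hT'c.measurable, ← hπ1, ← hπ2, Measure.map_map hi measurable_fst,
        Measure.map_map hi measurable_snd]
      by_cases hip : i ∈ p
      · congr 2 <;> ext w <;> simp [T, T', hip]
      · rw [add_comm]
        congr 2 <;> ext w <;> simp [T, T', hip]
    rw [← hγ.1 i, ← hρ, Measure.map_add _ _ hi, Measure.map_add _ _ hi, Measure.map_smul,
      Measure.map_smul, hsum]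
  have hγ'p := isProbabilityMeasure_of_mem_couplings i₀ hγ'
  have hcγ : Integrable c γ := integrable_of_mem_couplings hc hμ hγ.1
  have hcγ' : Integrable c γ' := integrable_of_mem_couplings hc hμ hγ'
  have hopt := hγ.2 γ' hγ'
  rw [← hρ] at hcγ hopt
  have hscale : ∀ ν : Measure (∀ i, M i), Integrable c (t • ν) → Integrable c ν := by
    intro ν hν
    exact (integrable_smul_measure (c := (t : ENNReal)) (by simpa using ht.ne')
      (by simp)).1 hν
  obtain ⟨hcρ, hcab⟩ := integrable_add_measure.1 hcγ
  have hcTT := (integrable_add_measure.1 hcγ').2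
  obtain ⟨hca, hcb⟩ := integrable_add_measure.1 (hscale _ hcab)
  obtain ⟨hcT, hcT'⟩ := integrable_add_measure.1 (hscale _ hcTT)
  rw [integral_add_measure hcρ hcab, integral_add_measure hcρ hcTT, integral_smul_nnreal_measure,
    integral_smul_nnreal_measure, integral_add_measure hca hcb, integral_add_measure hcT hcT',
    add_le_add_iff_left] at hopt
  have hopt' := (smul_le_smul_iff_of_pos_left ht).1 hopt
  rw [← hπ1] at hca
  rw [← hπ2] at hcb
  rw [← hπ1, ← hπ2] at hopt'
  rw [integral_map measurable_fst.aemeasurable hc.aestronglyMeasurable,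
    integral_map measurable_snd.aemeasurable hc.aestronglyMeasurable,
    integral_map hTc.aemeasurable hc.aestronglyMeasurable,
    integral_map hT'c.aemeasurable hc.aestronglyMeasurable] at hopt'
  have i1 : Integrable (fun w => c w.1) π := hca.comp_measurable measurable_fst
  have i2 : Integrable (fun w => c w.2) π := hcb.comp_measurable measurable_snd
  have i3 : Integrable (fun w => c (T w)) π := hcT.comp_measurable hTc.measurable
  have i4 : Integrable (fun w => c (T' w)) π := hcT'.comp_measurable hT'c.measurable
  have hint : ∫ w, h w ∂π ≤ 0 := by
    have h1 := integral_sub (i1.add i2) (i3.add i4)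
    rw [integral_add' i1 i2, integral_add' i3 i4] at h1
    refine h1.trans_le ?_
    linarith
  have hposae : ∀ᵐ w ∂π, 0 < h w := by
    have h1 : ∀ᵐ w ∂π, w.1 ∈ U := ae_of_ae_map measurable_fst.aemeasurable (by rwa [hπ1])
    have h2 : ∀ᵐ w ∂π, w.2 ∈ V := ae_of_ae_map measurable_snd.aemeasurable (by rwa [hπ2])
    filter_upwards [h1, h2] with w hw1 hw2
    exact hUV (Set.mk_mem_prod (hUU hw1) (hVV hw2))
  have hi : Integrable h π := (i1.add i2).sub (i3.add i4)
  have hzero := (integral_eq_zero_iff_of_nonneg_ae (hposae.mono fun w hw => hw.le) hi).1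
    (le_antisymm hint (integral_nonneg_of_ae (hposae.mono fun w hw => hw.le)))
  obtain ⟨w, hw1, hw2⟩ := (hposae.and hzero).exists
  exact hw1.ne' hw2

end Couplings

/-! ### Monotone sets in local coordinates -/

/-- The identification of the model space with the Euclidean space on pairs of indices. -/
noncomputable def flatten (m n : ℕ) :
    (Fin m → EuclideanSpace ℝ (Fin n)) ≃L[ℝ] EuclideanSpace ℝ (Fin m × Fin n) :=
  LinearEquiv.toContinuousLinearEquiv
    { toFun := fun u => WithLp.toLp 2 fun a => u a.1 a.2
      invFun := fun v i => WithLp.toLp 2 fun α => v (i, α)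
      map_add' := fun _ _ => rfl
      map_smul' := fun _ _ => rfl
      left_inv := fun _ => rfl
      right_inv := fun _ => rfl }

theorem ofLp_flatten {m n : ℕ} (u : Fin m → EuclideanSpace ℝ (Fin n)) :
    (flatten m n u).ofLp = fun a => u a.1 a.2 := rfl

section Local

variable {m n : ℕ} {M : Fin m → Type*} [∀ i, TopologicalSpace (M i)]
  [∀ i, ChartedSpace (EuclideanSpace ℝ (Fin n)) (M i)] {c : (∀ i, M i) → ℝ} {x : ∀ i, M i}

/-- Near a point where the cost is `C²`, the forms in the convex hull are almost nonpositive on the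
differences of points which are `c`-monotone for every partition. -/
theorem exists_form_le_of_monotone (hc : ContDiffAt ℝ 2 (localCost (n := n) c x) (localPoint x))
    {ε : ℝ} (hε : 0 < ε) :
    ∃ r > 0, ∀ y ∈ Metric.ball (localPoint (n := n) x) r,
      ∀ z ∈ Metric.ball (localPoint (n := n) x) r,
        (∀ p : Finset (Fin m), localCost (n := n) c x y + localCost (n := n) c x z ≤
          localCost (n := n) c x (p.piecewise y z) + localCost (n := n) c x (p.piecewise z y)) →
        ∀ g ∈ partitionHull n c x,
          (fun a : Fin m × Fin n => (y - z) a.1 a.2) ⬝ᵥ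
            g.mulVec (fun a : Fin m × Fin n => (y - z) a.1 a.2) ≤ ε * ‖y - z‖ ^ 2 := by
  obtain ⟨r, hr, htaylor⟩ := eventually_second_difference_le hc (half_pos hε)
  refine ⟨r, hr, fun y hy z hz hmono g hg => ?_⟩
  -- Balls of the sup norm are products of balls, hence stable under exchanging coordinates.
  have hpw : ∀ (p : Finset (Fin m)) (y z : Fin m → EuclideanSpace ℝ (Fin n)),
      y ∈ Metric.ball (localPoint (n := n) x) r → z ∈ Metric.ball (localPoint (n := n) x) r →
        p.piecewise y z ∈ Metric.ball (localPoint (n := n) x) r := by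
    intro p y z hy hz
    rw [Metric.mem_ball, dist_pi_lt_iff hr] at *
    intro i
    by_cases hi : i ∈ p
    · simpa [hi] using hy i
    · simpa [hi] using hz i
  have hconv : Convex ℝ {A : Matrix (Fin m × Fin n) (Fin m × Fin n) ℝ |
      (fun a : Fin m × Fin n => (y - z) a.1 a.2) ⬝ᵥ
        A.mulVec (fun a : Fin m × Fin n => (y - z) a.1 a.2) ≤ ε * ‖y - z‖ ^ 2} := by
    refine convex_halfSpace_le ⟨fun A B => ?_, fun a A => ?_⟩ _
    · rw [Matrix.add_mulVec, dotProduct_add]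
    · rw [Matrix.smul_mulVec, dotProduct_smul]
  refine convexHull_min ?_ hconv hg
  rintro _ ⟨p, -, rfl⟩
  have hs : z + p.piecewise (y - z) 0 = p.piecewise y z := by
    ext1 i
    by_cases hi : i ∈ p <;> simp [hi]
  have ht : z + p.piecewise 0 (y - z) = p.piecewise z y := by
    ext1 i
    by_cases hi : i ∈ p <;> simp [hi]
  have hst : p.piecewise y z + p.piecewise 0 (y - z) = y := by
    ext1 i
    by_cases hi : i ∈ p <;> simp [hi]
  have h1 := htaylor z (p.piecewise (y - z) 0) (p.piecewise 0 (y - z)) hz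
    (by rw [hs]; exact hpw p y z hy hz) (by rw [ht]; exact hpw p z y hz hy)
    (by rw [hs, hst]; exact hy)
  have hns : ‖p.piecewise (y - z) 0‖ ≤ ‖y - z‖ := by
    refine (pi_norm_le_iff_of_nonneg (norm_nonneg _)).2 fun i => ?_
    by_cases hi : i ∈ p
    · simpa [hi] using norm_le_pi_norm (y - z) i
    · simp [hi]
  have hnt : ‖p.piecewise 0 (y - z)‖ ≤ ‖y - z‖ := by
    refine (pi_norm_le_iff_of_nonneg (norm_nonneg _)).2 fun i => ?_
    by_cases hi : i ∈ p
    · simp [hi]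
    · simpa [hi] using norm_le_pi_norm (y - z) i
  rw [hs, hst, ht] at h1
  have h2 := (abs_le.1 h1).1
  have h3 := hmono p
  have h4 : ε / 2 * ‖p.piecewise 0 (y - z)‖ * ‖p.piecewise (y - z) 0‖ ≤
      ε / 2 * ‖y - z‖ * ‖y - z‖ := by gcongr
  rw [Set.mem_ofPred_eq, dotProduct_partitionForm hc]
  linarith

/-- Near a nondegenerate point, the difference of two points which are `c`-monotone for every
partition lies in a cone around a fixed `n`-dimensional subspace, in local coordinates. -/
theorem exists_cone_of_monotone (hc : ContDiffAt ℝ 2 (localCost (n := n) c x) (localPoint x))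
    (hx : MMA2 n c x) :
    ∃ V W : Submodule ℝ (Fin m → EuclideanSpace ℝ (Fin n)), IsCompl V W ∧
      Module.finrank ℝ V = n ∧ ∃ K : ℝ≥0, ∃ r > 0,
        ∀ y ∈ Metric.ball (localPoint (n := n) x) r, ∀ z ∈ Metric.ball (localPoint (n := n) x) r,
          (∀ p : Finset (Fin m), localCost (n := n) c x y + localCost (n := n) c x z ≤
            localCost (n := n) c x (p.piecewise y z) + localCost (n := n) c x (p.piecewise z y)) →
          ∀ v ∈ V, ∀ w ∈ W, y - z = v + w → ‖w‖ ≤ K * ‖v‖ := by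
  obtain ⟨g, hg, hsig⟩ := hx
  obtain ⟨V, W, hVW, hV, ε, hε, K, hK, hcone⟩ :=
    exists_isCompl_cone (isHermitian_of_mem_partitionHull hc hg) hsig
  obtain ⟨e, he⟩ : ∃ e : (Fin m → EuclideanSpace ℝ (Fin n)) ≃L[ℝ] EuclideanSpace ℝ (Fin m × Fin n),
      ∀ u, (e u).ofLp = fun a => u a.1 a.2 := ⟨flatten m n, ofLp_flatten⟩
  obtain ⟨C, hC0, hC⟩ : ∃ C : ℝ, 0 ≤ C ∧ ∀ u, ‖u‖ ≤ C * ‖e u‖ := by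
    have h := fun u => e.antilipschitz.le_mul_dist u 0
    simp only [dist_zero_right, map_zero] at h
    exact ⟨_, NNReal.coe_nonneg _, h⟩
  obtain ⟨C', hC0', hC'⟩ : ∃ C : ℝ, 0 ≤ C ∧ ∀ u, ‖e u‖ ≤ C * ‖u‖ := by
    have h := fun u => e.lipschitz.dist_le_mul u 0
    simp only [dist_zero_right, map_zero] at h
    exact ⟨_, NNReal.coe_nonneg _, h⟩
  -- The factor `C ^ 2 + 1` absorbs the change from sup to Euclidean norm; the `+ 1` keeps the
  -- denominator positive when `C = 0`.
  obtain ⟨r, hr, hform⟩ := exists_form_le_of_monotone hc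
    (ε := ε / (C ^ 2 + 1)) (by positivity)
  have hcompl : IsCompl (V.map e.symm.toLinearEquiv.toLinearMap)
      (W.map e.symm.toLinearEquiv.toLinearMap) :=
    (Submodule.orderIsoMapComap e.symm.toLinearEquiv).isCompl hVW
  refine ⟨_, _, hcompl, (LinearEquiv.finrank_map_eq e.symm.toLinearEquiv V).trans hV,
    ⟨C * K * C', by positivity⟩, r, hr, fun y hy z hz hmono v' hv' w' hw' hyz => ?_⟩
  obtain ⟨v, hv, rfl⟩ := Submodule.mem_map.1 hv'
  obtain ⟨w, hw, rfl⟩ := Submodule.mem_map.1 hw'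
  change y - z = e.symm v + e.symm w at hyz
  change ‖e.symm w‖ ≤ C * K * C' * ‖e.symm v‖
  have hyz' : e (y - z) = v + w := by
    rw [hyz, map_add, e.apply_symm_apply, e.apply_symm_apply]
  have hgform := hform y hy z hz hmono g hg
  rw [← he (y - z)] at hgform
  have hnorm : ε / (C ^ 2 + 1) * ‖y - z‖ ^ 2 ≤ ε * ‖e (y - z)‖ ^ 2 := by
    calc ε / (C ^ 2 + 1) * ‖y - z‖ ^ 2 ≤ ε / (C ^ 2 + 1) * (C * ‖e (y - z)‖) ^ 2 := by
          gcongr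
          exact hC _
      _ ≤ ε / (C ^ 2 + 1) * ((C ^ 2 + 1) * ‖e (y - z)‖ ^ 2) := by
          rw [mul_pow]
          gcongr
          linarith
      _ = ε * ‖e (y - z)‖ ^ 2 := by field_simp
  have hle := hgform.trans hnorm
  rw [hyz'] at hle
  have h1 := hcone v hv w hw hle
  have h2 := hC (e.symm w)
  have h3 := hC' (e.symm v)
  rw [e.apply_symm_apply] at h2 h3
  calc ‖e.symm w‖ ≤ C * ‖w‖ := h2
    _ ≤ C * (K * (C' * ‖e.symm v‖)) := by gcongr; exact h1.trans (by gcongr)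
    _ = C * K * C' * ‖e.symm v‖ := by ring

theorem localCost_chartAt {y : ∀ i, M i}
    (hy : ∀ i, y i ∈ (chartAt (EuclideanSpace ℝ (Fin n)) (x i)).source) :
    localCost (n := n) c x (fun i => chartAt (EuclideanSpace ℝ (Fin n)) (x i) (y i)) = c y := by
  unfold localCost
  congr 1
  ext i
  exact (chartAt (EuclideanSpace ℝ (Fin n)) (x i)).left_inv (hy i)

theorem piecewise_chartAt (p : Finset (Fin m)) (y z : ∀ i, M i) :
    p.piecewise (fun i => chartAt (EuclideanSpace ℝ (Fin n)) (x i) (y i))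
        (fun i => chartAt (EuclideanSpace ℝ (Fin n)) (x i) (z i)) =
      fun i => chartAt (EuclideanSpace ℝ (Fin n)) (x i) (p.piecewise y z i) := by
  ext1 i
  by_cases hi : i ∈ p <;> simp [hi]

end Local

end MultiMarginal

/-! ### Lipschitz structure of the support -/

theorem corollary2p1p4 {m n : ℕ} {M : Fin m → Type*}
    [∀ i, TopologicalSpace (M i)] [∀ i, T2Space (M i)] [∀ i, SecondCountableTopology (M i)]
    [∀ i, ChartedSpace (EuclideanSpace ℝ (Fin n)) (M i)] [∀ i, IsManifold (𝓡 n) ∞ (M i)]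
    [∀ i, MeasurableSpace (M i)] [∀ i, BorelSpace (M i)]
    (c : (∀ i, M i) → ℝ) (hc : Continuous c) (x : ∀ i, M i)
    (hc2 : ContMDiffAt (MultiMarginal.prodModel m n) 𝓘(ℝ, ℝ) 2 c x)
    (hx : MultiMarginal.MMA2 n c x) :
    ∃ N ∈ 𝓝 x, ∀ (μ : ∀ i, Measure (M i)), (∀ i, IsProbabilityMeasure (μ i)) →
      (∀ i, IsCompact (μ i).support) →
      ∀ γ : Measure (∀ i, M i), MultiMarginal.IsOptimal c μ γ →
        ∃ S : Set (∀ i, M i),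
          MultiMarginal.IsLipschitzSubmanifold (MultiMarginal.prodModel m n) n S ∧
          N ∩ γ.support ⊆ S := by
  obtain ⟨V, W, hVW, hV, K, r, hr, hcone⟩ :=
    MultiMarginal.exists_cone_of_monotone (MultiMarginal.contDiffAt_localCost hc2) hx
  let φ := chartAt (ModelPi fun _ : Fin m => EuclideanSpace ℝ (Fin n)) x
  have hsource : ∀ y, y ∈ φ.source ↔
      ∀ i, y i ∈ (chartAt (EuclideanSpace ℝ (Fin n)) (x i)).source := fun y => by
    exact Set.mem_univ_pi
  let ψ : (∀ i, M i) → Fin m → EuclideanSpace ℝ (Fin n) := φ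
  have hψ : ContinuousAt ψ x := φ.continuousAt (mem_chart_source _ x)
  let N : Set (∀ i, M i) := φ.source ∩ ψ ⁻¹' Metric.ball (MultiMarginal.localPoint (n := n) x) r
  have hN : N ∈ 𝓝 x := Filter.inter_mem (chart_source_mem_nhds _ x)
    (hψ.preimage_mem_nhds (Metric.ball_mem_nhds _ hr))
  refine ⟨N, hN, fun μ hμ hμK γ hγ => ?_⟩
  obtain ⟨f, K', hf, hgraph⟩ := MultiMarginal.exists_lipschitz_graph hVW (K := K)
    (s := ψ '' (N ∩ γ.support)) (by
      rintro _ ⟨y, ⟨hyN, hys⟩, rfl⟩ _ ⟨z, ⟨hzN, hzs⟩, rfl⟩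
      refine hcone _ hyN.2 _ hzN.2 fun p => ?_
      have hy := (hsource y).1 hyN.1
      have hz := (hsource z).1 hzN.1
      have hpw : ∀ y z : ∀ i, M i,
          (∀ i, y i ∈ (chartAt (EuclideanSpace ℝ (Fin n)) (x i)).source) →
          (∀ i, z i ∈ (chartAt (EuclideanSpace ℝ (Fin n)) (x i)).source) →
          ∀ i, p.piecewise y z i ∈ (chartAt (EuclideanSpace ℝ (Fin n)) (x i)).source := by
        intro y z hy hz i
        by_cases hi : i ∈ p
        · simpa [hi] using hy i
        · simpa [hi] using hz i
      have h := MultiMarginal.add_le_of_mem_support hc hμK hγ hys hzs p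
      rw [← MultiMarginal.localCost_chartAt (c := c) (x := x) hy,
        ← MultiMarginal.localCost_chartAt (c := c) (x := x) hz,
        ← MultiMarginal.localCost_chartAt (c := c) (x := x) (hpw y z hy hz),
        ← MultiMarginal.localCost_chartAt (c := c) (x := x) (hpw z y hz hy),
        ← MultiMarginal.piecewise_chartAt, ← MultiMarginal.piecewise_chartAt] at h
      exact h)
  -- Taking the whole graph inside the chart domain lets the single chart `φ` serve at every point
  -- of `S`.
  refine ⟨{y | y ∈ φ.source ∧ ∃ v : V, ψ y = v + f v}, ?_, ?_⟩
  · intro y hy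
    refine ⟨φ, chart_mem_atlas _ x, φ.source, φ.open_source, hy.1, subset_rfl, V, W, hVW,
      inferInstance, hV, f, K', hf, fun z hz => ?_⟩
    exact and_iff_right hz
  · intro y hy
    exact ⟨hy.1.1, hgraph _ (Set.mem_image_of_mem ψ hy)⟩
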